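/- **Theorem 3 (rate region of joint network and channel decoding).** Consider a network with nodes $1,2,3,4$ and links $1\to3$, $2\to3$, $3\to4$, $1\to4$. The links are independent memoryless binary symmetric channels with crossover probabilities $p_{1,3},p_{2,3},p_{3,4},p_{1,4}\in[0,1]$, each used $n$ times. Node 1 encodes a message $A$ into a word $\mathbf X_1(A)\in\{0,1\}^n$, which it sends on both links $1\to3$ and $1\to4$; node 2 encodes a message $B$ into $\mathbf X_2(B)\in\{0,1\}^n$, which it sends on $2\to3$. The messages $A,B$ are independent and uniform on alphabets of sizes $\lfloor 2^{nR_A}\rfloor$ and $\lfloor 2^{nR_B}\rfloor$, where $R_A,R_B\ge 0$. The relay, node 3, sends on $3\to4$ the bit-wise XOR $\mathbf Y_{1,3}\oplus\mathbf Y_{2,3}$ of the two words it receives. Node 4 computes an estimate $(\hat A,\hat B)$ from the received words $(\mathbf Y_{1,4},\mathbf Y_{3,4})$. A pair $(R_A,R_B)$ is *achievable* if for every $\varepsilon>0$ and every sufficiently large $n$ there are encoders and a decoder with $\Pr\{(\hat A,\hat B)\ne(A,B)\}<\varepsilon$, and *achievable with linear codes* if both encoders can in addition be taken linear, i.e. the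 $M$ messages are labelled by distinct binary vectors $\mathbf u$ of length $\lceil\log_2 M\rceil$ and $\mathbf u$ is encoded as $\mathbf uG$ with a binary generator matrix $G$. The achievable rate region is the closure of the set of achievable pairs. For $p\in[0,1]$ let $H(p)=-p\log_2p-(1-p)\log_2(1-p)$, where $0\log_2 0=0$, and for independent bits $E_{i,j}$ with $\Pr\{E_{i,j}=1\}=p_{i,j}$ let $$p'=\Pr\{E_{1,3}\oplus E_{2,3}\oplus E_{3,4}=1\},\qquad p''=\Pr\{E_{1,3}\oplus E_{2,3}\oplus E_{3,4}\oplus E_{1,4}=1\}.$$ Put $\mathbb C_{1,4}=1-H(p_{1,4})$, $\mathbb C'=1-H(p')$ and $\mathbb C''=1-H(p'')$. Then the achievable rate region $\Lambda_{\mathrm{joint}}$, both with linear codes and with arbitrary codes, is the convex hull of all pairs $(R_A,R_B)$ with $R_A,R_B\ge0$ and $$R_A\le \mathbb C_{1,4}+\mathbb C'-\mathbb C'',\qquad R_B\le\mathbb C',\qquad R_A+R_B\le\mathbb C_{1,4}+\mathbb C'.$$ -/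

import Mathlib

open scoped Matrix

noncomputable section

namespace RelayNet

/-- Binary words of length `n`; addition is the bit-wise XOR. -/
abbrev Word (n : ℕ) : Type := Fin n → ZMod 2

/-- The crossover probabilities of the links `1 → 3`, `2 → 3`, `3 → 4` and `1 → 4`. -/
structure Crossover where
  p13 : ℝ
  p23 : ℝ
  p34 : ℝ
  p14 : ℝ

/-- Every crossover probability is a probability. -/
def Crossover.Valid (q : Crossover) : Prop :=
  q.p13 ∈ Set.Icc 0 1 ∧ q.p23 ∈ Set.Icc 0 1 ∧ q.p34 ∈ Set.Icc 0 1 ∧ q.p14 ∈ Set.Icc 0 1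

/-- Transition probability `Pr{Y = y | X = x}` of a binary symmetric channel. -/
def bsc (p : ℝ) (x y : ZMod 2) : ℝ := if y = x then 1 - p else p

/-- `n` independent uses of a binary symmetric channel. -/
def bscWord (p : ℝ) {n : ℕ} (x y : Word n) : ℝ := ∏ i, bsc p (x i) (y i)

/-- `Pr{Y₁₄ = y14, Y₃₄ = y34}` when node 1 sends `x1` on both of its links and node 2 sends `x2`.
The four links are independent; the relay receives `y13`, `y23` and sends `y13 + y23`. -/
def networkLaw (q : Crossover) {n : ℕ} (x1 x2 y14 y34 : Word n) : ℝ :=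
  bscWord q.p14 x1 y14 *
    ∑ y13 : Word n, ∑ y23 : Word n,
      bscWord q.p13 x1 y13 * bscWord q.p23 x2 y23 * bscWord q.p34 (y13 + y23) y34

/-- `Pr{(Â, B̂) ≠ (A, B)}` for independent uniform messages `A`, `B`, encoders `fA`, `fB` and the
joint decoder `g`, which sees `(Y₁₄, Y₃₄)`. -/
def errorProb (q : Crossover) {n MA MB : ℕ} (fA : Fin MA → Word n) (fB : Fin MB → Word n)
    (g : Word n → Word n → Fin MA × Fin MB) : ℝ :=
  (∑ a, ∑ b, ∑ y14, ∑ y34,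
    if g y14 y34 ≠ (a, b) then networkLaw q (fA a) (fB b) y14 y34 else 0) / (MA * MB)

/-- The encoder `f` of `M` messages is linear: the messages are labelled by distinct binary vectors
`u` of the least possible length `⌈log₂ M⌉`, and `u` is encoded as `u G` for a generator matrix. -/
def IsLinearEncoder {M n : ℕ} (f : Fin M → Word n) : Prop :=
  ∃ (u : Fin M → Word (Nat.clog 2 M)) (G : Matrix (Fin (Nat.clog 2 M)) (Fin n) (ZMod 2)),
    Function.Injective u ∧ ∀ m, f m = u m ᵥ* G

/-- The size `⌊2^{nR}⌋` of the message alphabet at rate `R` and block length `n`. -/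
def numMessages (n : ℕ) (R : ℝ) : ℕ := ⌊(2 : ℝ) ^ ((n : ℝ) * R)⌋₊

/-- The rate pairs `(R_A, R_B)` that joint decoding achieves: for every `ε > 0` and all large block
lengths there are codes of these rates with error probability below `ε`. -/
def achievable (q : Crossover) : Set (ℝ × ℝ) :=
  {R | 0 ≤ R.1 ∧ 0 ≤ R.2 ∧ ∀ ε : ℝ, 0 < ε → ∃ N : ℕ, ∀ n : ℕ, N ≤ n →
    ∃ (fA : Fin (numMessages n R.1) → Word n) (fB : Fin (numMessages n R.2) → Word n)
      (g : Word n → Word n → Fin (numMessages n R.1) × Fin (numMessages n R.2)),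
      errorProb q fA fB g < ε}

/-- The rate pairs that joint decoding achieves with linear encoders at both sources. -/
def achievableLinear (q : Crossover) : Set (ℝ × ℝ) :=
  {R | 0 ≤ R.1 ∧ 0 ≤ R.2 ∧ ∀ ε : ℝ, 0 < ε → ∃ N : ℕ, ∀ n : ℕ, N ≤ n →
    ∃ (fA : Fin (numMessages n R.1) → Word n) (fB : Fin (numMessages n R.2) → Word n)
      (g : Word n → Word n → Fin (numMessages n R.1) × Fin (numMessages n R.2)),
      IsLinearEncoder fA ∧ IsLinearEncoder fB ∧ errorProb q fA fB g < ε}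

/-- Capacity `1 - H(p)`, in bits, of a binary symmetric channel. -/
def bscCapacity (p : ℝ) : ℝ := 1 - Real.binEntropy p / Real.log 2

/-- `p' = Pr{E₁₃ ⊕ E₂₃ ⊕ E₃₄ = 1}`. -/
def Crossover.p' (q : Crossover) : ℝ :=
  ((1 - q.p13) * (1 - q.p23) + q.p13 * q.p23) * q.p34 +
    (q.p13 * (1 - q.p23) + (1 - q.p13) * q.p23) * (1 - q.p34)

/-- `p'' = Pr{E₁₃ ⊕ E₂₃ ⊕ E₃₄ ⊕ E₁₄ = 1}`. -/
def Crossover.p'' (q : Crossover) : ℝ :=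
  q.p13 * (1 - q.p23) * (1 - q.p34) * (1 - q.p14) +
  (1 - q.p13) * q.p23 * (1 - q.p34) * (1 - q.p14) +
  (1 - q.p13) * (1 - q.p23) * q.p34 * (1 - q.p14) +
  (1 - q.p13) * (1 - q.p23) * (1 - q.p34) * q.p14 +
  (1 - q.p13) * q.p23 * q.p34 * q.p14 +
  q.p13 * (1 - q.p23) * q.p34 * q.p14 +
  q.p13 * q.p23 * (1 - q.p34) * q.p14 +
  q.p13 * q.p23 * q.p34 * (1 - q.p14)

/-- The nonnegative rate pairs that satisfy the three rate constraints. -/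
def ratePairs (q : Crossover) : Set (ℝ × ℝ) :=
  {R | 0 ≤ R.1 ∧ 0 ≤ R.2 ∧
    R.1 ≤ bscCapacity q.p14 + bscCapacity q.p' - bscCapacity q.p'' ∧
    R.2 ≤ bscCapacity q.p' ∧
    R.1 + R.2 ≤ bscCapacity q.p14 + bscCapacity q.p'}

end RelayNet

end

/-! The relay adds words bit by bit, so its noise folds into a single binary symmetric channel: node
4 sees `y14 = x1 + z₁` and `y34 = x1 + x2 + z₂`, with independent noise words `z₁`, `z₂` of
crossover `p14` and `p'` (`networkLaw_eq`). The sum of the outputs is `x2 + z₁ + z₂`, free of `x1`,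
and `z₁ + z₂` has crossover `p''`. Outside an event of vanishing probability, `z₁`, `z₂` and `z₁ +
z₂` are all typical (`tendsto_jointAtypicalMass`). Both directions count such noise pairs; below,
`H₁₄`, `H'`, `H''` are the three entropies in bits.

Converse: each output pair decodes to one message pair, so correct decoding under typical noise has
total weight at most the number of relevant outputs times the largest typical probability. All `4 ^
n` outputs give the sum bound; giving away `A` bounds `R_B`. Giving away `B` leaves only outputs
whose sum is `x2` plus a `p''`-typical word, about `2 ^ (n (1 + H''))` of them, which produces the
term `- C''`.

Direct part: with random generator matrices the difference of two distinct codewords is uniform, so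
a union bound over wrong `A`, wrong `B` and both wrong suffices (`exists_linear_code`). A wrong `A`
alone shifts both noise words by the same word and keeps `z₁ + z₂`, so about `2 ^ (n (H₁₄ + H' -
H''))` shifts remain typical (`sum_confusion_left`). This matches the converse.

The polytope `ratePairs` is already closed and convex, so the convex hull changes nothing. -/

namespace RelayNet

open Filter Topology

/-! ### Noise words and the reduction to two additive-noise channels -/

/-- The probability that `n` independent uses of a binary symmetric channel have noise word `z`. -/
noncomputable def noise (p : ℝ) {n : ℕ} (z : Word n) : ℝ := ∏ i, bsc p 0 (z i)

/-- Crossover probability of two binary symmetric channels in series. -/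
noncomputable def binConv (p r : ℝ) : ℝ := p * (1 - r) + (1 - p) * r

lemma binConv_mem {p r : ℝ} (hp : p ∈ Set.Icc (0 : ℝ) 1) (hr : r ∈ Set.Icc (0 : ℝ) 1) :
    binConv p r ∈ Set.Icc (0 : ℝ) 1 := by
  obtain ⟨h1, h2⟩ := hp
  obtain ⟨h3, h4⟩ := hr
  unfold binConv
  constructor <;> nlinarith [mul_nonneg h1 h3, mul_nonneg (sub_nonneg.2 h2) (sub_nonneg.2 h4),
    mul_nonneg h1 (sub_nonneg.2 h4), mul_nonneg h3 (sub_nonneg.2 h2)]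

lemma Crossover.p'_eq (q : Crossover) : q.p' = binConv q.p13 (binConv q.p23 q.p34) := by
  unfold Crossover.p' binConv; ring

lemma Crossover.p''_eq (q : Crossover) : q.p'' = binConv q.p14 q.p' := by
  unfold Crossover.p'' Crossover.p' binConv; ring

lemma Crossover.Valid.p'_mem {q : Crossover} (hq : q.Valid) : q.p' ∈ Set.Icc (0 : ℝ) 1 := by
  rw [q.p'_eq]
  exact binConv_mem hq.1 (binConv_mem hq.2.1 hq.2.2.1)

lemma Crossover.Valid.p''_mem {q : Crossover} (hq : q.Valid) : q.p'' ∈ Set.Icc (0 : ℝ) 1 := by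
  rw [q.p''_eq]
  exact binConv_mem hq.2.2.2 hq.p'_mem

lemma word_add_self {n : ℕ} (z : Word n) : z + z = 0 := by
  funext i; exact CharTwo.add_self_eq_zero _

lemma word_neg {n : ℕ} (z : Word n) : -z = z := by
  funext i; exact CharTwo.neg_eq _

lemma word_sub {n : ℕ} (z w : Word n) : z - w = z + w := by
  rw [sub_eq_add_neg, word_neg]

lemma bsc_nonneg {p : ℝ} (hp : p ∈ Set.Icc (0 : ℝ) 1) (x y : ZMod 2) : 0 ≤ bsc p x y := by
  unfold bsc; split_ifs <;> linarith [hp.1, hp.2]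

lemma noise_nonneg {p : ℝ} (hp : p ∈ Set.Icc (0 : ℝ) 1) {n : ℕ} (z : Word n) : 0 ≤ noise p z :=
  Finset.prod_nonneg fun _ _ => bsc_nonneg hp _ _

lemma bscWord_eq_noise (p : ℝ) {n : ℕ} (x y : Word n) : bscWord p x y = noise p (y - x) := by
  unfold bscWord noise bsc
  refine Finset.prod_congr rfl fun i _ => ?_
  simp only [Pi.sub_apply, sub_eq_zero]

lemma sum_zmod_two (f : ZMod 2 → ℝ) : ∑ b, f b = f 0 + f 1 := Fin.sum_univ_two f

lemma sum_prod_word (n : ℕ) (f : Fin n → ZMod 2 → ℝ) :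
    ∑ z : Word n, ∏ i, f i (z i) = ∏ i, ∑ b, f i b := by
  rw [Finset.prod_univ_sum, Fintype.piFinset_univ]

lemma sum_noise (p : ℝ) (n : ℕ) : ∑ z : Word n, noise p z = 1 := by
  unfold noise
  rw [sum_prod_word n fun _ => bsc p 0]
  simp [sum_zmod_two, bsc]

lemma sum_noise_mul_noise (p r : ℝ) {n : ℕ} (s : Word n) :
    ∑ z : Word n, noise p z * noise r (s - z) = noise (binConv p r) s := by
  unfold noise
  simp_rw [← Finset.prod_mul_distrib, Pi.sub_apply]
  rw [sum_prod_word n fun i b => bsc p 0 b * bsc r 0 (s i - b)]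
  refine Finset.prod_congr rfl fun i _ => ?_
  rw [sum_zmod_two]
  have key : ∀ b : ZMod 2, bsc p 0 0 * bsc r 0 (b - 0) + bsc p 0 1 * bsc r 0 (b - 1) =
      bsc (binConv p r) 0 b := by
    intro b
    have h10 : (1 : ZMod 2) ≠ 0 := by decide
    have h01 : (0 : ZMod 2) - 1 ≠ 0 := by decide
    fin_cases b
    · change bsc p 0 0 * bsc r 0 (0 - 0) + bsc p 0 1 * bsc r 0 (0 - 1) = bsc (binConv p r) 0 0
      simp only [bsc, binConv, sub_self, if_true, if_neg h10, if_neg h01]; ring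
    · change bsc p 0 0 * bsc r 0 (1 - 0) + bsc p 0 1 * bsc r 0 (1 - 1) = bsc (binConv p r) 0 1
      simp only [bsc, binConv, sub_self, sub_zero, if_true, if_neg h10]; ring
  exact key _

lemma sum_noise_mul_noise_shift (p r : ℝ) {n : ℕ} (x t : Word n) :
    ∑ y : Word n, noise p (y - x) * noise r (t - y) = noise (binConv p r) (t - x) := by
  rw [← sum_noise_mul_noise, ← Equiv.sum_comp (Equiv.addRight x)]
  refine Finset.sum_congr rfl fun z _ => ?_
  simp only [Equiv.coe_addRight]
  congr 2 <;> abel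

/-- Summing out `y23` and then `y13` gives two convolutions of noise laws, which merge the links `2
→ 3`, `3 → 4` and `1 → 3` into one channel. -/
lemma networkLaw_eq (q : Crossover) {n : ℕ} (x1 x2 y14 y34 : Word n) :
    networkLaw q x1 x2 y14 y34 = noise q.p14 (y14 - x1) * noise q.p' (y34 - x1 - x2) := by
  unfold networkLaw
  simp_rw [bscWord_eq_noise, mul_assoc, ← Finset.mul_sum]
  have h : ∀ y13 : Word n,
      ∑ y23 : Word n, noise q.p23 (y23 - x2) * noise q.p34 (y34 - (y13 + y23)) =
        noise (binConv q.p23 q.p34) (y34 - x2 - y13) := by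
    intro y13
    rw [show y34 - x2 - y13 = y34 - y13 - x2 by abel, ← sum_noise_mul_noise_shift]
    simp_rw [sub_sub]
  simp_rw [h]
  rw [sum_noise_mul_noise_shift, q.p'_eq, show y34 - x2 - x1 = y34 - x1 - x2 by abel]

/-! ### Typical noise words -/

/-- Chernoff bound for sums of independent identically distributed functions of a bit. -/
lemma chernoff (μ f : ZMod 2 → ℝ) (hμ : ∀ b, 0 ≤ μ b) (h1 : ∑ b, μ b = 1)
    (hf : ∑ b, μ b * f b < 0) :
    ∃ r : ℝ, 0 ≤ r ∧ r < 1 ∧ ∀ (n : ℕ) (S : Word n → Prop) [DecidablePred S],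
      (∀ z, S z → (∏ i, μ (z i)) ≠ 0 → 0 ≤ ∑ i, f (z i)) →
      ∑ z : Word n, (if S z then ∏ i, μ (z i) else 0) ≤ r ^ n := by
  -- The moment generating function equals 1 at `s = 0` and has the negative mean as its derivative
  -- there, so it drops below 1 at some small `s > 0`.
  have hd : HasDerivAt (fun s : ℝ => ∑ b, μ b * Real.exp (s * f b)) (∑ b, μ b * f b) 0 := by
    have : ∀ b ∈ (Finset.univ : Finset (ZMod 2)),
        HasDerivAt (fun s : ℝ => μ b * Real.exp (s * f b)) (μ b * f b) 0 := by
      intro b _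
      have := (((hasDerivAt_id (0 : ℝ)).mul_const (f b)).exp).const_mul (μ b)
      simpa using this
    simpa using HasDerivAt.fun_sum this
  obtain ⟨s, hs0, hs⟩ : ∃ s : ℝ, 0 < s ∧ ∑ b, μ b * Real.exp (s * f b) < 1 := by
    have hlt : ∀ᶠ s in 𝓝[>] (0 : ℝ), slope (fun s : ℝ => ∑ b, μ b * Real.exp (s * f b)) 0 s < 0 :=
      ((hasDerivAt_iff_tendsto_slope.1 hd).mono_left
        (nhdsWithin_mono _ fun x hx => ne_of_gt hx)).eventually (gt_mem_nhds hf)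
    obtain ⟨s, hs, hs0⟩ := (hlt.and self_mem_nhdsWithin).exists
    refine ⟨s, hs0, ?_⟩
    have hs0' : (0 : ℝ) < s := hs0
    rw [slope_def_field, sub_zero, div_lt_iff₀ hs0'] at hs
    simp only [zero_mul, Real.exp_zero, mul_one, h1] at hs
    linarith
  refine ⟨_, Finset.sum_nonneg fun b _ => mul_nonneg (hμ b) (Real.exp_pos _).le, hs, ?_⟩
  intro n S _ hS
  calc ∑ z : Word n, (if S z then ∏ i, μ (z i) else 0)
      ≤ ∑ z : Word n, ∏ i, μ (z i) * Real.exp (s * f (z i)) := by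
        refine Finset.sum_le_sum fun z _ => ?_
        have hp : 0 ≤ ∏ i, μ (z i) := Finset.prod_nonneg fun _ _ => hμ _
        rw [Finset.prod_mul_distrib, ← Real.exp_sum, ← Finset.mul_sum]
        split_ifs with h
        -- Words of probability zero are exempt from `hS`: for them `Real.log 0 = 0` would spoil the
        -- log-likelihood when the crossover is 0 or 1.
        · by_cases h0 : ∏ i, μ (z i) = 0
          · simp [h0]
          · exact le_mul_of_one_le_right hp
              (Real.one_le_exp (mul_nonneg hs0.le (hS z h h0)))
        · exact mul_nonneg hp (Real.exp_pos _).le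
    _ = _ := by
        rw [sum_prod_word n fun _ b => μ b * Real.exp (s * f b)]
        simp

/-- Binary entropy in bits. -/
noncomputable def entropyBits (p : ℝ) : ℝ := Real.binEntropy p / Real.log 2

lemma bscCapacity_eq (p : ℝ) : bscCapacity p = 1 - entropyBits p := rfl

/-- A noise word is typical when its probability is `2 ^ (-n (H(p) ± δ))`. -/
def Typical (p δ : ℝ) {n : ℕ} (z : Word n) : Prop :=
  (2 : ℝ) ^ (-(n * (entropyBits p + δ))) ≤ noise p z ∧
    noise p z ≤ (2 : ℝ) ^ (-(n * (entropyBits p - δ)))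

open Classical in
/-- Probability that the noise is not typical. -/
noncomputable def atypicalMass (p δ : ℝ) (n : ℕ) : ℝ :=
  ∑ z : Word n, if Typical p δ z then 0 else noise p z

lemma sum_bsc_mul_log (p : ℝ) :
    ∑ b, bsc p 0 b * Real.log (bsc p 0 b) = -(Real.log 2 * entropyBits p) := by
  have h2 : Real.log 2 ≠ 0 := (Real.log_pos one_lt_two).ne'
  rw [entropyBits, mul_div_cancel₀ _ h2, sum_zmod_two, Real.binEntropy]
  simp [bsc]

lemma log_noise {p : ℝ} {n : ℕ} {z : Word n} (hz : noise p z ≠ 0) :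
    Real.log (noise p z) = ∑ i, Real.log (bsc p 0 (z i)) := by
  unfold noise at *
  exact Real.log_prod (fun i hi => (Finset.prod_ne_zero_iff.1 hz) i hi)

/-- The log-likelihood of the noise is a sum of independent terms of mean `-H(p) log 2`. For either
deviation by `δ` the recentred summand has mean `-δ log 2 < 0`, so both tails decay exponentially.
-/
theorem tendsto_atypicalMass {p δ : ℝ} (hp : p ∈ Set.Icc (0 : ℝ) 1) (hδ : 0 < δ) :
    Tendsto (atypicalMass p δ) atTop (𝓝 0) := by
  classical
  have hl2 : 0 < Real.log 2 := Real.log_pos one_lt_two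
  have h1 : ∑ b, bsc p 0 b = 1 := by simp [sum_zmod_two, bsc]
  have hE := sum_bsc_mul_log p
  obtain ⟨r, hr0, hr1, hr⟩ := chernoff (bsc p 0)
    (fun b => -Real.log (bsc p 0 b) - Real.log 2 * (entropyBits p + δ)) (bsc_nonneg hp 0) h1 (by
      simp only [mul_sub, mul_neg, Finset.sum_sub_distrib, Finset.sum_neg_distrib,
        ← Finset.sum_mul, h1, hE]
      nlinarith)
  obtain ⟨t, ht0, ht1, ht⟩ := chernoff (bsc p 0)
    (fun b => Real.log (bsc p 0 b) + Real.log 2 * (entropyBits p - δ)) (bsc_nonneg hp 0) h1 (by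
      simp only [mul_add, Finset.sum_add_distrib, ← Finset.sum_mul, h1, hE]
      nlinarith)
  have hbound : ∀ n, atypicalMass p δ n ≤ r ^ n + t ^ n := by
    intro n
    have hrn := hr n (fun z => noise p z < (2 : ℝ) ^ (-(n * (entropyBits p + δ)))) (by
      intro z hz h0
      have hpos : 0 < noise p z := lt_of_le_of_ne (noise_nonneg hp z) (Ne.symm h0)
      have hlog := Real.log_le_log hpos hz.le
      rw [Real.log_rpow two_pos, log_noise hpos.ne'] at hlog
      simp only [Finset.sum_sub_distrib, Finset.sum_neg_distrib, Finset.sum_const,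
        Finset.card_univ, Fintype.card_fin, nsmul_eq_mul]
      linarith)
    have htn := ht n (fun z => (2 : ℝ) ^ (-(n * (entropyBits p - δ))) < noise p z) (by
      intro z hz h0
      have hpos : 0 < noise p z := lt_of_le_of_ne (noise_nonneg hp z) (Ne.symm h0)
      have hlog := Real.log_le_log (Real.rpow_pos_of_pos two_pos _) hz.le
      rw [Real.log_rpow two_pos, log_noise hpos.ne'] at hlog
      simp only [Finset.sum_add_distrib, Finset.sum_const,
        Finset.card_univ, Fintype.card_fin, nsmul_eq_mul]
      linarith)
    refine le_trans ?_ (add_le_add hrn htn)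
    rw [← Finset.sum_add_distrib]
    refine Finset.sum_le_sum fun z _ => ?_
    have hz := noise_nonneg hp z
    change _ ≤ (if _ then noise p z else 0) + (if _ then noise p z else 0)
    by_cases hT : Typical p δ z
    · rw [if_pos hT]; split_ifs <;> linarith
    · rw [if_neg hT]
      unfold Typical at hT
      rw [not_and_or, not_le, not_le] at hT
      rcases hT with h | h
      · rw [if_pos h]; split_ifs <;> linarith
      · rw [if_pos h]; split_ifs <;> linarith
  refine squeeze_zero (fun n => ?_) hbound ?_
  · refine Finset.sum_nonneg fun z _ => ?_
    split_ifs
    exacts [le_rfl, noise_nonneg hp z]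
  · simpa using (tendsto_pow_atTop_nhds_zero_of_lt_one hr0 hr1).add
      (tendsto_pow_atTop_nhds_zero_of_lt_one ht0 ht1)

-- Each typical word has probability at least `2 ^ (-n (H(p) + δ))`, and the probabilities sum to 1.
open Classical in
lemma card_typical_le {p : ℝ} (hp : p ∈ Set.Icc (0 : ℝ) 1) (δ : ℝ) (n : ℕ) :
    (((Finset.univ : Finset (Word n)).filter (Typical p δ)).card : ℝ) ≤
      (2 : ℝ) ^ (n * (entropyBits p + δ)) := by
  have h : (((Finset.univ : Finset (Word n)).filter (Typical p δ)).card : ℝ) *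
      (2 : ℝ) ^ (-(n * (entropyBits p + δ))) ≤ 1 := by
    rw [← sum_noise p n, ← nsmul_eq_mul]
    refine (Finset.card_nsmul_le_sum _ (noise p) _ fun z hz => (Finset.mem_filter.1 hz).2.1).trans ?_
    exact Finset.sum_le_sum_of_subset_of_nonneg (Finset.subset_univ _) fun z _ _ => noise_nonneg hp z
  rw [Real.rpow_neg two_pos.le, ← div_eq_mul_inv,
    div_le_one (Real.rpow_pos_of_pos two_pos _)] at h
  exact h

/-! ### Joint typicality of the noise pair -/

/-- The pair of noise words is typical, and so is their sum. -/
def JointlyTypical (q : Crossover) (δ : ℝ) {n : ℕ} (z₁ z₂ : Word n) : Prop :=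
  Typical q.p14 δ z₁ ∧ Typical q.p' δ z₂ ∧ Typical q.p'' δ (z₁ + z₂)

open Classical in
/-- Probability that the noise pair is not jointly typical. -/
noncomputable def jointAtypicalMass (q : Crossover) (δ : ℝ) (n : ℕ) : ℝ :=
  ∑ z₁ : Word n, ∑ z₂ : Word n,
    if JointlyTypical q δ z₁ z₂ then 0 else noise q.p14 z₁ * noise q.p' z₂

lemma sum_noise_mul_noise_sum (q : Crossover) {n : ℕ} (f : Word n → ℝ) :
    ∑ z₁ : Word n, ∑ z₂ : Word n, noise q.p14 z₁ * noise q.p' z₂ * f (z₁ + z₂) =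
      ∑ s : Word n, noise q.p'' s * f s := by
  simp_rw [q.p''_eq, ← sum_noise_mul_noise, Finset.sum_mul]
  refine Eq.trans (Finset.sum_congr rfl fun z₁ _ => ?_) Finset.sum_comm
  refine Eq.trans ?_ (Equiv.sum_comp (Equiv.addLeft z₁) _)
  simp

lemma jointAtypicalMass_nonneg {q : Crossover} (hq : q.Valid) (δ : ℝ) (n : ℕ) :
    0 ≤ jointAtypicalMass q δ n := by
  refine Finset.sum_nonneg fun z₁ _ => Finset.sum_nonneg fun z₂ _ => ?_
  split_ifs
  exacts [le_rfl, mul_nonneg (noise_nonneg hq.2.2.2 _) (noise_nonneg hq.p'_mem _)]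

/-- Union bound: each single mass is rewritten as a sum over noise pairs, the third through the law
of `z₁ + z₂`. -/
lemma jointAtypicalMass_le {q : Crossover} (hq : q.Valid) (δ : ℝ) (n : ℕ) :
    jointAtypicalMass q δ n ≤
      atypicalMass q.p14 δ n + atypicalMass q.p' δ n + atypicalMass q.p'' δ n := by
  classical
  have e1 : atypicalMass q.p14 δ n = ∑ z₁ : Word n, ∑ z₂ : Word n,
      noise q.p14 z₁ * noise q.p' z₂ * (if Typical q.p14 δ z₁ then 0 else 1) := by
    simp_rw [mul_right_comm _ (noise q.p' _), ← Finset.mul_sum, sum_noise, mul_one]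
    exact Finset.sum_congr rfl fun z _ => by split_ifs <;> simp
  have e2 : atypicalMass q.p' δ n = ∑ z₁ : Word n, ∑ z₂ : Word n,
      noise q.p14 z₁ * noise q.p' z₂ * (if Typical q.p' δ z₂ then 0 else 1) := by
    simp_rw [mul_assoc, ← Finset.mul_sum, ← Finset.sum_mul, sum_noise, one_mul]
    exact Finset.sum_congr rfl fun z _ => by split_ifs <;> simp
  have e3 : atypicalMass q.p'' δ n = ∑ z₁ : Word n, ∑ z₂ : Word n,
      noise q.p14 z₁ * noise q.p' z₂ * (if Typical q.p'' δ (z₁ + z₂) then 0 else 1) := by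
    rw [sum_noise_mul_noise_sum q fun s => if Typical q.p'' δ s then 0 else 1]
    exact Finset.sum_congr rfl fun z _ => by split_ifs <;> simp
  rw [e1, e2, e3, ← Finset.sum_add_distrib, ← Finset.sum_add_distrib]
  refine Finset.sum_le_sum fun z₁ _ => ?_
  rw [← Finset.sum_add_distrib, ← Finset.sum_add_distrib]
  refine Finset.sum_le_sum fun z₂ _ => ?_
  have h := mul_nonneg (noise_nonneg hq.2.2.2 z₁) (noise_nonneg hq.p'_mem z₂)
  by_cases h1 : Typical q.p14 δ z₁ <;> by_cases h2 : Typical q.p' δ z₂ <;>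
    by_cases h3 : Typical q.p'' δ (z₁ + z₂) <;> simp [JointlyTypical, h1, h2, h3] <;> linarith

theorem tendsto_jointAtypicalMass {q : Crossover} (hq : q.Valid) {δ : ℝ} (hδ : 0 < δ) :
    Tendsto (jointAtypicalMass q δ) atTop (𝓝 0) := by
  refine squeeze_zero (jointAtypicalMass_nonneg hq δ) (jointAtypicalMass_le hq δ) ?_
  simpa using ((tendsto_atypicalMass hq.2.2.2 hδ).add (tendsto_atypicalMass hq.p'_mem hδ)).add
    (tendsto_atypicalMass hq.p''_mem hδ)

/-! ### Converse: bounds on the weight of correct decoding -/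

lemma sum_ite_le_of_subsingleton {ι : Type*} [Fintype ι] (P : ι → Prop) [DecidablePred P]
    (hP : ∀ i j, P i → P j → i = j) {X : ι → ℝ} {K : ℝ} (hK : 0 ≤ K) (hX : ∀ i, X i ≤ K) :
    ∑ i, (if P i then X i else 0) ≤ K := by
  by_cases h : ∃ i, P i
  · obtain ⟨i, hi⟩ := h
    rw [Finset.sum_eq_single_of_mem i (Finset.mem_univ i), if_pos hi]
    · exact hX i
    · intro j _ hj
      rw [if_neg fun hPj => hj (hP j i hPj hi)]
  · push Not at h
    simpa [h] using hK

lemma sum_shift_sub {n : ℕ} (F : Word n → ℝ) (x : Word n) : ∑ y, F (y - x) = ∑ z, F z :=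
  Equiv.sum_comp (Equiv.subRight x) F

lemma sum_sum_shift {n : ℕ} (F : Word n → Word n → ℝ) (x1 x2 : Word n) :
    ∑ y14, ∑ y34, F (y14 - x1) (y34 - x1 - x2) = ∑ z₁, ∑ z₂, F z₁ z₂ := by
  simp_rw [sub_sub _ x1 x2, sum_shift_sub (F _)]
  exact sum_shift_sub (fun z => ∑ z₂, F z z₂) x1

lemma sum_networkLaw (q : Crossover) {n : ℕ} (x1 x2 : Word n) :
    ∑ y14, ∑ y34, networkLaw q x1 x2 y14 y34 = 1 := by
  simp_rw [networkLaw_eq]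
  rw [sum_sum_shift fun z₁ z₂ => noise q.p14 z₁ * noise q.p' z₂]
  simp_rw [← Finset.mul_sum, sum_noise, mul_one, sum_noise]

open Classical in
/-- Probability of an output pair together with the event that the noise is jointly typical. -/
noncomputable def typicalLaw (q : Crossover) (δ : ℝ) {n : ℕ} (x1 x2 y14 y34 : Word n) : ℝ :=
  if JointlyTypical q δ (y14 - x1) (y34 - x1 - x2) then networkLaw q x1 x2 y14 y34 else 0

/-- Total weight, over all message pairs, of correct decoding under jointly typical noise. -/
noncomputable def typicalSuccess (q : Crossover) (δ : ℝ) {n MA MB : ℕ} (fA : Fin MA → Word n)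
    (fB : Fin MB → Word n) (g : Word n → Word n → Fin MA × Fin MB) : ℝ :=
  ∑ a, ∑ b, ∑ y14, ∑ y34,
    if g y14 y34 = (a, b) then typicalLaw q δ (fA a) (fB b) y14 y34 else 0

lemma networkLaw_nonneg {q : Crossover} (hq : q.Valid) {n : ℕ} (x1 x2 y14 y34 : Word n) :
    0 ≤ networkLaw q x1 x2 y14 y34 := by
  rw [networkLaw_eq]
  exact mul_nonneg (noise_nonneg hq.2.2.2 _) (noise_nonneg hq.p'_mem _)

/-- Every term of the total weight `MA * MB` is decoded wrongly, has atypical noise, or counts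
towards `typicalSuccess`. -/
lemma one_sub_errorProb_le {q : Crossover} (hq : q.Valid) (δ : ℝ) {n MA MB : ℕ}
    (hA : 0 < MA) (hB : 0 < MB) (fA : Fin MA → Word n)
    (fB : Fin MB → Word n) (g : Word n → Word n → Fin MA × Fin MB) :
    (1 - errorProb q fA fB g - jointAtypicalMass q δ n) * (MA * MB) ≤
      typicalSuccess q δ fA fB g := by
  classical
  have hM : (MA * MB : ℝ) ≠ 0 := by positivity
  have h1 : errorProb q fA fB g * (MA * MB) = ∑ a, ∑ b, ∑ y14, ∑ y34,
      if g y14 y34 ≠ (a, b) then networkLaw q (fA a) (fB b) y14 y34 else 0 := by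
    rw [errorProb, div_mul_cancel₀ _ hM]
  have h2 : (MA * MB : ℝ) = ∑ a, ∑ b, ∑ y14, ∑ y34, networkLaw q (fA a) (fB b) y14 y34 := by
    simp [sum_networkLaw]
  have h3 : jointAtypicalMass q δ n * (MA * MB) = ∑ a, ∑ b, ∑ y14, ∑ y34,
      if JointlyTypical q δ (y14 - fA a) (y34 - fA a - fB b) then 0
        else networkLaw q (fA a) (fB b) y14 y34 := by
    simp_rw [networkLaw_eq]
    have : ∀ a b, (∑ y14, ∑ y34, if JointlyTypical q δ (y14 - fA a) (y34 - fA a - fB b) then 0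
        else noise q.p14 (y14 - fA a) * noise q.p' (y34 - fA a - fB b)) =
        jointAtypicalMass q δ n := fun a b =>
      sum_sum_shift (fun z₁ z₂ => if JointlyTypical q δ z₁ z₂ then 0
        else noise q.p14 z₁ * noise q.p' z₂) (fA a) (fB b)
    simp_rw [this]
    simp only [Finset.sum_const, Finset.card_univ, Fintype.card_fin, nsmul_eq_mul]
    ring
  rw [sub_mul, sub_mul, one_mul, h1, h3, h2, sub_sub, sub_le_iff_le_add, typicalSuccess]
  simp_rw [← Finset.sum_add_distrib]
  refine Finset.sum_le_sum fun a _ => Finset.sum_le_sum fun b _ => Finset.sum_le_sum fun y14 _ =>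
    Finset.sum_le_sum fun y34 _ => ?_
  have := networkLaw_nonneg hq (fA a) (fB b) y14 y34
  unfold typicalLaw
  by_cases hg : g y14 y34 = (a, b) <;>
    by_cases hT : JointlyTypical q δ (y14 - fA a) (y34 - fA a - fB b) <;> simp [hg, hT, this]

lemma card_word (n : ℕ) : (Fintype.card (Word n) : ℝ) = (2 : ℝ) ^ (n : ℝ) := by
  simp [Fintype.card_pi, ZMod.card]

lemma typicalLaw_le {q : Crossover} (hq : q.Valid) (δ : ℝ) {n : ℕ} (x1 x2 y14 y34 : Word n) :
    typicalLaw q δ x1 x2 y14 y34 ≤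
      (2 : ℝ) ^ (-(n * (entropyBits q.p14 - δ))) * (2 : ℝ) ^ (-(n * (entropyBits q.p' - δ))) := by
  unfold typicalLaw
  split_ifs with h
  · rw [networkLaw_eq]
    exact mul_le_mul h.1.2 h.2.1.2 (noise_nonneg hq.p'_mem _) (Real.rpow_pos_of_pos two_pos _).le
  · positivity

lemma typicalLaw_le_noise_mul {q : Crossover} (hq : q.Valid) (δ : ℝ) {n : ℕ}
    (x1 x2 y14 y34 : Word n) :
    typicalLaw q δ x1 x2 y14 y34 ≤
      noise q.p14 (y14 - x1) * (2 : ℝ) ^ (-(n * (entropyBits q.p' - δ))) := by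
  have h0 := noise_nonneg hq.2.2.2 (y14 - x1)
  unfold typicalLaw
  split_ifs with h
  · rw [networkLaw_eq]
    exact mul_le_mul_of_nonneg_left h.2.1.2 h0
  · positivity

/-- The decoder selects one message pair per output, so each of the `4 ^ n` outputs contributes at
most one typical probability. -/
lemma typicalSuccess_le_sum {q : Crossover} (hq : q.Valid) (δ : ℝ) {n MA MB : ℕ}
    (fA : Fin MA → Word n) (fB : Fin MB → Word n) (g : Word n → Word n → Fin MA × Fin MB) :
    typicalSuccess q δ fA fB g ≤
      (2 : ℝ) ^ (n * (bscCapacity q.p14 + bscCapacity q.p' + 2 * δ)) := by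
  have hre : typicalSuccess q δ fA fB g = ∑ y14, ∑ y34, ∑ ab : Fin MA × Fin MB,
      if g y14 y34 = ab then typicalLaw q δ (fA ab.1) (fB ab.2) y14 y34 else 0 := by
    unfold typicalSuccess
    refine (Fintype.sum_prod_type' _).symm.trans ?_
    rw [Finset.sum_comm]
    exact Finset.sum_congr rfl fun y14 _ => Finset.sum_comm
  rw [hre]
  calc _ ≤ ∑ _y14 : Word n, ∑ _y34 : Word n, (2 : ℝ) ^ (-(n * (entropyBits q.p14 - δ))) *
        (2 : ℝ) ^ (-(n * (entropyBits q.p' - δ))) :=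
        Finset.sum_le_sum fun y14 _ => Finset.sum_le_sum fun y34 _ =>
          sum_ite_le_of_subsingleton _ (fun i j hi hj => hi.symm.trans hj) (by positivity)
            fun ab => typicalLaw_le hq δ _ _ _ _
    _ = _ := by
        simp only [Finset.sum_const, Finset.card_univ, nsmul_eq_mul, card_word,
          ← Real.rpow_add two_pos, bscCapacity_eq]
        ring_nf

/-- With `a` fixed, only the `b` chosen by the decoder survives at each output; the law of `y14`
sums to 1, which leaves `2 ^ n` words `y34`. -/
lemma typicalSuccess_le_right {q : Crossover} (hq : q.Valid) (δ : ℝ) {n MA MB : ℕ}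
    (fA : Fin MA → Word n) (fB : Fin MB → Word n) (g : Word n → Word n → Fin MA × Fin MB) :
    typicalSuccess q δ fA fB g ≤ MA * (2 : ℝ) ^ (n * (bscCapacity q.p' + δ)) := by
  have hre : typicalSuccess q δ fA fB g = ∑ a, ∑ y14, ∑ y34, ∑ b,
      if g y14 y34 = (a, b) then typicalLaw q δ (fA a) (fB b) y14 y34 else 0 := by
    unfold typicalSuccess
    refine Finset.sum_congr rfl fun a _ => ?_
    rw [Finset.sum_comm]
    exact Finset.sum_congr rfl fun y14 _ => Finset.sum_comm
  rw [hre]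
  calc _ ≤ ∑ a : Fin MA, ∑ y14 : Word n, ∑ _y34 : Word n,
          noise q.p14 (y14 - fA a) * (2 : ℝ) ^ (-(n * (entropyBits q.p' - δ))) :=
        Finset.sum_le_sum fun a _ => Finset.sum_le_sum fun y14 _ => Finset.sum_le_sum fun y34 _ =>
          sum_ite_le_of_subsingleton _
            (fun i j hi hj => (Prod.ext_iff.1 (hi.symm.trans hj)).2)
            (mul_nonneg (noise_nonneg hq.2.2.2 _) (Real.rpow_pos_of_pos two_pos _).le)
            fun b => typicalLaw_le_noise_mul hq δ _ _ _ _
    _ = _ := by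
        simp only [Finset.sum_const, Finset.card_univ, nsmul_eq_mul, card_word,
          ← Finset.mul_sum, ← Finset.sum_mul, sum_shift_sub (noise q.p14), sum_noise, one_mul,
          Fintype.card_fin, ← Real.rpow_add two_pos, bscCapacity_eq]
        ring_nf

lemma word_add_cancel {n : ℕ} (y14 y34 x1 x2 : Word n) :
    y14 - x1 + (y34 - x1 - x2) = y34 - (x2 - y14) := by
  have : x1 + x1 = 0 := word_add_self x1
  calc _ = y34 - (x2 - y14) - (x1 + x1) := by abel
    _ = _ := by rw [this, sub_zero]

/-- With `b` fixed, `word_add_cancel` removes `x1` from the sum of the outputs. Given `y14`, only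
about `2 ^ (n H'')` words `y34` are compatible with a typical `z₁ + z₂`, instead of `2 ^ n`. -/
lemma typicalSuccess_le_left {q : Crossover} (hq : q.Valid) (δ : ℝ) {n MA MB : ℕ}
    (fA : Fin MA → Word n) (fB : Fin MB → Word n) (g : Word n → Word n → Fin MA × Fin MB) :
    typicalSuccess q δ fA fB g ≤ MB *
      (2 : ℝ) ^ (n * (bscCapacity q.p14 + bscCapacity q.p' - bscCapacity q.p'' + 3 * δ)) := by
  classical
  have hre : typicalSuccess q δ fA fB g = ∑ b, ∑ y14, ∑ y34, ∑ a,
      if g y14 y34 = (a, b) then typicalLaw q δ (fA a) (fB b) y14 y34 else 0 := by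
    unfold typicalSuccess
    rw [Finset.sum_comm]
    refine Finset.sum_congr rfl fun b _ => ?_
    rw [Finset.sum_comm]
    exact Finset.sum_congr rfl fun y14 _ => Finset.sum_comm
  rw [hre]
  set K : ℝ := (2 : ℝ) ^ (-(n * (entropyBits q.p14 - δ))) *
    (2 : ℝ) ^ (-(n * (entropyBits q.p' - δ))) with hK
  have hK0 : 0 ≤ K := by positivity
  calc _ ≤ ∑ b : Fin MB, ∑ y14 : Word n, ∑ y34 : Word n,
          (if Typical q.p'' δ (y34 - (fB b - y14)) then K else 0) := by
        refine Finset.sum_le_sum fun b _ => Finset.sum_le_sum fun y14 _ =>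
          Finset.sum_le_sum fun y34 _ => sum_ite_le_of_subsingleton _
            (fun i j hi hj => (Prod.ext_iff.1 (hi.symm.trans hj)).1)
            (by split_ifs <;> simp [hK0]) fun a => ?_
        split_ifs with h
        · exact typicalLaw_le hq δ _ _ _ _
        · unfold typicalLaw
          rw [if_neg]
          intro hT
          exact h (word_add_cancel y14 y34 (fA a) (fB b) ▸ hT.2.2)
    _ = MB * ((2 : ℝ) ^ (n : ℝ) *
          (((Finset.univ : Finset (Word n)).filter (Typical q.p'' δ)).card * K)) := by
        have : ∀ x : Word n, ∑ y34 : Word n, (if Typical q.p'' δ (y34 - x) then K else 0) =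
            ((Finset.univ : Finset (Word n)).filter (Typical q.p'' δ)).card * K := by
          intro x
          rw [sum_shift_sub (fun z => if Typical q.p'' δ z then K else 0), ← Finset.sum_filter,
            Finset.sum_const, nsmul_eq_mul]
        simp_rw [this]
        simp only [Finset.sum_const, Finset.card_univ, nsmul_eq_mul, card_word, Fintype.card_fin]
    _ ≤ MB * ((2 : ℝ) ^ (n : ℝ) * ((2 : ℝ) ^ (n * (entropyBits q.p'' + δ)) * K)) := by
        gcongr
        exact card_typical_le hq.p''_mem δ n
    _ = _ := by
        rw [hK]
        simp only [← Real.rpow_add two_pos, bscCapacity_eq]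
        ring_nf

lemma numMessages_pos (n : ℕ) {R : ℝ} (hR : 0 ≤ R) : 0 < numMessages n R := by
  unfold numMessages
  rw [Nat.floor_pos]
  exact Real.one_le_rpow one_le_two (by positivity)

lemma le_two_mul_numMessages (n : ℕ) {R : ℝ} (hR : 0 ≤ R) :
    (2 : ℝ) ^ (n * R) ≤ 2 * numMessages n R := by
  have h1 : (2 : ℝ) ^ (n * R) < numMessages n R + 1 := Nat.lt_floor_add_one _
  have h2 : (1 : ℝ) ≤ numMessages n R := by exact_mod_cast numMessages_pos n hR
  linarith

lemma le_of_eventually_rpow_le {x y K : ℝ}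
    (h : ∀ᶠ n : ℕ in atTop, (2 : ℝ) ^ (n * x) ≤ K * (2 : ℝ) ^ (n * y)) : x ≤ y := by
  by_contra! hxy
  have h1 : Tendsto (fun n : ℕ => ((2 : ℝ) ^ (x - y)) ^ n) atTop atTop :=
    tendsto_pow_atTop_atTop_of_one_lt (Real.one_lt_rpow one_lt_two (sub_pos.2 hxy))
  obtain ⟨n, hn, hK⟩ := (h.and (h1.eventually_gt_atTop K)).exists
  rw [← Real.rpow_natCast, ← Real.rpow_mul two_pos.le, mul_comm, mul_sub,
    Real.rpow_sub two_pos, lt_div_iff₀ (Real.rpow_pos_of_pos two_pos _)] at hK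
  linarith

theorem achievable_subset_ratePairs {q : Crossover} (hq : q.Valid) :
    achievable q ⊆ ratePairs q := by
  rintro ⟨RA, RB⟩ ⟨hA, hB, h⟩
  dsimp only at hA hB h
  -- Error below 1/2 and atypical mass below 1/4 leave a success fraction of at least 1/4, hence the
  -- factor 4 in `key`.
  obtain ⟨N, hN⟩ := h (1 / 2) (by norm_num)
  have key : ∀ δ : ℝ, 0 < δ → ∀ᶠ n : ℕ in atTop,
      ∃ (fA : Fin (numMessages n RA) → Word n) (fB : Fin (numMessages n RB) → Word n)
        (g : Word n → Word n → Fin (numMessages n RA) × Fin (numMessages n RB)),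
        (numMessages n RA : ℝ) * numMessages n RB ≤ 4 * typicalSuccess q δ fA fB g := by
    intro δ hδ
    filter_upwards [eventually_ge_atTop N,
      (tendsto_jointAtypicalMass hq hδ).eventually (gt_mem_nhds (by norm_num : (0 : ℝ) < 1 / 4))]
      with n hn hJ
    obtain ⟨fA, fB, g, hg⟩ := hN n hn
    refine ⟨fA, fB, g, ?_⟩
    have h1 := one_sub_errorProb_le hq δ (numMessages_pos n hA) (numMessages_pos n hB) fA fB g
    have h2 : (0 : ℝ) ≤ numMessages n RA * numMessages n RB := by positivity
    nlinarith
  have hpos : ∀ (n : ℕ) {R : ℝ}, 0 ≤ R → (0 : ℝ) < numMessages n R := fun n R hR => by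
    exact_mod_cast numMessages_pos n hR
  refine ⟨hA, hB, ?_, ?_, ?_⟩ <;> dsimp only
  · refine le_of_forall_pos_le_add fun ε hε => ?_
    -- The constant is 4 from `key` times 2 for the floor in `numMessages`; the sum rate below
    -- involves two floors.
    refine le_of_eventually_rpow_le (K := 8) ?_
    filter_upwards [key (ε / 3) (by positivity)] with n hn
    obtain ⟨fA, fB, g, hg⟩ := hn
    have h1 := typicalSuccess_le_left hq (ε / 3) fA fB g
    have h2 := le_two_mul_numMessages n hA
    rw [show 3 * (ε / 3) = ε by ring] at h1
    have h3 := le_of_mul_le_mul_left (a := (numMessages n RB : ℝ)) (by linarith :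
      (numMessages n RB : ℝ) * numMessages n RA ≤ numMessages n RB * (4 * (2 : ℝ) ^
        (n * (bscCapacity q.p14 + bscCapacity q.p' - bscCapacity q.p'' + ε)))) (hpos n hB)
    linarith
  · refine le_of_forall_pos_le_add fun ε hε => ?_
    refine le_of_eventually_rpow_le (K := 8) ?_
    filter_upwards [key ε hε] with n hn
    obtain ⟨fA, fB, g, hg⟩ := hn
    have h1 := typicalSuccess_le_right hq ε fA fB g
    have h2 := le_two_mul_numMessages n hB
    have h3 := le_of_mul_le_mul_left (a := (numMessages n RA : ℝ)) (by linarith :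
      (numMessages n RA : ℝ) * numMessages n RB ≤ numMessages n RA * (4 * (2 : ℝ) ^
        (n * (bscCapacity q.p' + ε)))) (hpos n hA)
    linarith
  · refine le_of_forall_pos_le_add fun ε hε => ?_
    refine le_of_eventually_rpow_le (K := 16) ?_
    filter_upwards [key (ε / 2) (by positivity)] with n hn
    obtain ⟨fA, fB, g, hg⟩ := hn
    have h1 := typicalSuccess_le_sum hq (ε / 2) fA fB g
    have h2 := mul_le_mul (le_two_mul_numMessages n hA) (le_two_mul_numMessages n hB)
      (Real.rpow_pos_of_pos two_pos _).le (by positivity)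
    rw [show 2 * (ε / 2) = ε by ring] at h1
    rw [mul_add, Real.rpow_add two_pos]
    linarith

/-! ### Direct part: random linear codes and typicality decoding -/

/-- The image of a nonzero vector under a uniformly random generator matrix is uniform. -/
lemma sum_vecMul {k n : ℕ} {v : Word k} (hv : v ≠ 0) (F : Word n → ℝ) :
    ∑ G : Matrix (Fin k) (Fin n) (ZMod 2), F (v ᵥ* G) =
      Fintype.card (Matrix (Fin k) (Fin n) (ZMod 2)) * ((2 : ℝ) ^ (-(n : ℝ)) * ∑ w, F w) := by
  obtain ⟨i, hi⟩ := Function.ne_iff.1 hv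
  have hi1 : v i = 1 := by
    have : ∀ b : ZMod 2, b ≠ 0 → b = 1 := by decide
    exact this _ hi
  have hshift : ∀ w : Word n, ∑ G : Matrix (Fin k) (Fin n) (ZMod 2), F (v ᵥ* G) =
      ∑ G : Matrix (Fin k) (Fin n) (ZMod 2), F (v ᵥ* G + w) := by
    intro w
    -- Since `v i = 1`, adding `w` to row `i` of `G` translates `v ᵥ* G` by `w`; so the sum over `G`
    -- is translation invariant and can be averaged over `w`.
    rw [← Equiv.sum_comp (Equiv.addRight (Matrix.vecMulVec (Pi.single i 1) w))]
    refine Finset.sum_congr rfl fun G _ => ?_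
    rw [Equiv.coe_addRight, Matrix.vecMul_add, Matrix.vecMul_vecMulVec]
    simp [hi1]
  have h2 : (2 : ℝ) ^ (n : ℝ) * ∑ G : Matrix (Fin k) (Fin n) (ZMod 2), F (v ᵥ* G) =
      Fintype.card (Matrix (Fin k) (Fin n) (ZMod 2)) * ∑ w, F w := by
    calc _ = ∑ w : Word n, ∑ G : Matrix (Fin k) (Fin n) (ZMod 2), F (v ᵥ* G) := by
          rw [Finset.sum_const, Finset.card_univ, nsmul_eq_mul, card_word]
      _ = ∑ G : Matrix (Fin k) (Fin n) (ZMod 2), ∑ w : Word n, F (v ᵥ* G + w) := by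
          rw [Finset.sum_comm (s := (Finset.univ : Finset (Matrix (Fin k) (Fin n) (ZMod 2))))]
          exact Finset.sum_congr rfl fun w _ => hshift w
      _ = ∑ _G : Matrix (Fin k) (Fin n) (ZMod 2), ∑ w : Word n, F w :=
          Finset.sum_congr rfl fun G _ => Equiv.sum_comp (Equiv.addLeft (v ᵥ* G)) F
      _ = _ := by rw [Finset.sum_const, Finset.card_univ, nsmul_eq_mul]
  have hpos : (0 : ℝ) < (2 : ℝ) ^ (n : ℝ) := by positivity
  rw [Real.rpow_neg two_pos.le, mul_left_comm, ← h2, inv_mul_cancel_left₀ hpos.ne']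

open Classical in
/-- Indicator that the noise pair, displaced by the difference of two codeword pairs, is
jointly typical. -/
noncomputable def confusion (q : Crossover) (δ : ℝ) {n : ℕ} (z₁ z₂ d₁ d₂ : Word n) : ℝ :=
  if JointlyTypical q δ (z₁ + d₁) (z₂ + d₁ + d₂) then 1 else 0

lemma confusion_nonneg (q : Crossover) (δ : ℝ) {n : ℕ} (z₁ z₂ d₁ d₂ : Word n) :
    0 ≤ confusion q δ z₁ z₂ d₁ d₂ := by
  unfold confusion; split_ifs <;> norm_num

open Classical in
lemma sum_typical_le {p : ℝ} (hp : p ∈ Set.Icc (0 : ℝ) 1) (δ : ℝ) {n : ℕ} (x : Word n) :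
    ∑ w : Word n, (if Typical p δ (x + w) then (1 : ℝ) else 0) ≤
      (2 : ℝ) ^ (n * (entropyBits p + δ)) := by
  refine (Equiv.sum_comp (Equiv.addLeft x)
    fun z => if Typical p δ z then (1 : ℝ) else 0).trans_le ?_
  rw [Finset.sum_boole]
  exact card_typical_le hp δ n

lemma sum_confusion_right {q : Crossover} (hq : q.Valid) (δ : ℝ) {n : ℕ} (z₁ z₂ d : Word n) :
    ∑ w, confusion q δ z₁ z₂ d w ≤ (2 : ℝ) ^ (n * (entropyBits q.p' + δ)) := by
  classical
  refine le_trans (Finset.sum_le_sum fun w _ => ?_) (sum_typical_le hq.p'_mem δ (z₂ + d))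
  unfold confusion
  by_cases h : JointlyTypical q δ (z₁ + d) (z₂ + d + w)
  · rw [if_pos h, if_pos h.2.1]
  · rw [if_neg h]; split_ifs <;> norm_num

lemma sum_confusion_both {q : Crossover} (hq : q.Valid) (δ : ℝ) {n : ℕ} (z₁ z₂ : Word n) :
    ∑ w₁, ∑ w₂, confusion q δ z₁ z₂ w₁ w₂ ≤
      (2 : ℝ) ^ (n * (entropyBits q.p14 + entropyBits q.p' + 2 * δ)) := by
  classical
  calc _ ≤ ∑ w₁, (if Typical q.p14 δ (z₁ + w₁) then (1 : ℝ) else 0) *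
        (2 : ℝ) ^ (n * (entropyBits q.p' + δ)) := by
        refine Finset.sum_le_sum fun w₁ _ => ?_
        split_ifs with h
        · rw [one_mul]
          exact sum_confusion_right hq δ z₁ z₂ w₁
        · rw [zero_mul]
          refine (Finset.sum_eq_zero fun w₂ _ => ?_).le
          exact if_neg fun hT => h hT.1
    _ ≤ (2 : ℝ) ^ (n * (entropyBits q.p14 + δ)) * (2 : ℝ) ^ (n * (entropyBits q.p' + δ)) := by
        rw [← Finset.sum_mul]
        gcongr
        exact sum_typical_le hq.2.2.2 δ z₁
    _ = _ := by
        rw [← Real.rpow_add two_pos]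
        ring_nf

lemma sum_noise_mul_noise_common (q : Crossover) {n : ℕ} (z₁ z₂ : Word n) :
    ∑ w, noise q.p14 (z₁ + w) * noise q.p' (z₂ + w) = noise q.p'' (z₁ + z₂) := by
  rw [q.p''_eq, ← sum_noise_mul_noise, ← Equiv.sum_comp (Equiv.addLeft z₁)
    fun z => noise q.p14 z * noise q.p' (z₁ + z₂ - z)]
  refine Finset.sum_congr rfl fun w _ => ?_
  rw [Equiv.coe_addLeft, add_sub_add_left_eq_sub, word_sub]

/-- A common shift `w` preserves `z₁ + z₂`. If this sum is typical, the probabilities of all shifted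
pairs add up to `noise q.p'' (z₁ + z₂)`, at most `2 ^ (-n (H'' - δ))`, and each typical one costs at
least `2 ^ (-n (H₁₄ + H' + 2 δ))`. If it is not, no shift is typical. -/
lemma sum_confusion_left {q : Crossover} (hq : q.Valid) (δ : ℝ) {n : ℕ} (z₁ z₂ : Word n) :
    ∑ w, confusion q δ z₁ z₂ w 0 ≤
      (2 : ℝ) ^ (n * (entropyBits q.p14 + entropyBits q.p' - entropyBits q.p'' + 3 * δ)) := by
  classical
  have hsum : ∀ w : Word n, z₁ + w + (z₂ + w) = z₁ + z₂ := fun w => by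
    rw [add_add_add_comm, word_add_self, add_zero]
  by_cases h : Typical q.p'' δ (z₁ + z₂)
  · set K : ℝ := (2 : ℝ) ^ (-(n * (entropyBits q.p14 + δ))) *
      (2 : ℝ) ^ (-(n * (entropyBits q.p' + δ))) with hK
    have hK0 : 0 < K := by positivity
    have h1 : (∑ w, confusion q δ z₁ z₂ w 0) * K ≤
        (2 : ℝ) ^ (-(n * (entropyBits q.p'' - δ))) := by
      refine le_trans ?_ h.2
      rw [← sum_noise_mul_noise_common, Finset.sum_mul]
      refine Finset.sum_le_sum fun w _ => ?_
      unfold confusion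
      rw [add_zero]
      split_ifs with hT
      · rw [one_mul]
        exact mul_le_mul hT.1.1 hT.2.1.1 (by positivity) (noise_nonneg hq.2.2.2 _)
      · rw [zero_mul]
        exact mul_nonneg (noise_nonneg hq.2.2.2 _) (noise_nonneg hq.p'_mem _)
    rw [← le_div_iff₀ hK0, hK, ← Real.rpow_add two_pos, ← Real.rpow_sub two_pos] at h1
    refine h1.trans_eq ?_
    ring_nf
  · rw [Finset.sum_eq_zero]
    · positivity
    · intro w _
      refine if_neg fun hT => h ?_
      have := hT.2.2
      rwa [add_zero, hsum] at this

/-- Joint typicality decoding: an error requires atypical noise or a confusable message pair. -/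
lemma exists_decoder {q : Crossover} (hq : q.Valid) (δ : ℝ) {n MA MB : ℕ}
    (hA : 0 < MA) (hB : 0 < MB) (fA : Fin MA → Word n) (fB : Fin MB → Word n) :
    ∃ g : Word n → Word n → Fin MA × Fin MB,
      errorProb q fA fB g * (MA * MB) ≤
        MA * MB * jointAtypicalMass q δ n + ∑ ab : Fin MA × Fin MB, ∑ z : Word n × Word n,
        noise q.p14 z.1 * noise q.p' z.2 *
          (∑ a ∈ Finset.univ.erase ab.1, confusion q δ z.1 z.2 (fA ab.1 - fA a) 0 +
           ∑ b ∈ Finset.univ.erase ab.2, confusion q δ z.1 z.2 0 (fB ab.2 - fB b) +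
           ∑ a ∈ Finset.univ.erase ab.1, ∑ b ∈ Finset.univ.erase ab.2,
             confusion q δ z.1 z.2 (fA ab.1 - fA a) (fB ab.2 - fB b)) := by
  classical
  let P : Word n → Word n → Fin MA × Fin MB → Prop := fun y14 y34 ab =>
    JointlyTypical q δ (y14 - fA ab.1) (y34 - fA ab.1 - fB ab.2)
  -- Any typical candidate will do: when the noise is typical the true pair is a candidate, so an
  -- error forces a second one. The default pair is output only when no candidate exists.
  let g : Word n → Word n → Fin MA × Fin MB := fun y14 y34 =>
    if h : ∃ ab, P y14 y34 ab then h.choose else (⟨0, hA⟩, ⟨0, hB⟩)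
  have hgP : ∀ y14 y34 ab, P y14 y34 ab → P y14 y34 (g y14 y34) := by
    intro y14 y34 ab h
    have hex : ∃ ab, P y14 y34 ab := ⟨ab, h⟩
    simp only [g, dif_pos hex]
    exact hex.choose_spec
  refine ⟨g, ?_⟩
  have hM : (MA * MB : ℝ) ≠ 0 := by positivity
  have hJ : (MA * MB : ℝ) * jointAtypicalMass q δ n = ∑ _ab : Fin MA × Fin MB,
      ∑ z : Word n × Word n,
        if JointlyTypical q δ z.1 z.2 then 0 else noise q.p14 z.1 * noise q.p' z.2 := by
    rw [Finset.sum_const, Finset.card_univ, nsmul_eq_mul, Fintype.card_prod, Fintype.card_fin,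
      Fintype.card_fin, Nat.cast_mul, Fintype.sum_prod_type]
    rfl
  rw [errorProb, div_mul_cancel₀ _ hM, hJ, ← Finset.sum_add_distrib]
  refine ((Fintype.sum_prod_type' _).symm.trans_le (Finset.sum_le_sum fun ab _ => ?_))
  obtain ⟨a, b⟩ := ab
  dsimp only
  rw [← Finset.sum_add_distrib, ← Fintype.sum_prod_type']
  -- Change of variables from outputs to noise words.
  rw [← Equiv.sum_comp (Equiv.addRight ((fA a, fA a + fB b) : Word n × Word n))]
  refine Finset.sum_le_sum fun z _ => ?_
  obtain ⟨z₁, z₂⟩ := z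
  simp only [Equiv.coe_addRight, Prod.mk_add_mk, networkLaw_eq]
  have e1 : z₁ + fA a - fA a = z₁ := add_sub_cancel_right _ _
  have e2 : z₂ + (fA a + fB b) - fA a - fB b = z₂ := by abel
  rw [e1, e2]
  have hp := mul_nonneg (noise_nonneg hq.2.2.2 z₁) (noise_nonneg hq.p'_mem z₂)
  have n1 : 0 ≤ ∑ a' ∈ Finset.univ.erase a, confusion q δ z₁ z₂ (fA a - fA a') 0 :=
    Finset.sum_nonneg fun _ _ => confusion_nonneg ..
  have n2 : 0 ≤ ∑ b' ∈ Finset.univ.erase b, confusion q δ z₁ z₂ 0 (fB b - fB b') :=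
    Finset.sum_nonneg fun _ _ => confusion_nonneg ..
  have n3 : 0 ≤ ∑ a' ∈ Finset.univ.erase a, ∑ b' ∈ Finset.univ.erase b,
      confusion q δ z₁ z₂ (fA a - fA a') (fB b - fB b') :=
    Finset.sum_nonneg fun _ _ => Finset.sum_nonneg fun _ _ => confusion_nonneg ..
  by_cases hT : JointlyTypical q δ z₁ z₂
  swap
  · rw [if_neg hT]
    have := mul_nonneg hp (add_nonneg (add_nonneg n1 n2) n3)
    split_ifs <;> linarith
  rw [if_pos hT, zero_add]
  split_ifs with hg
  swap
  · exact mul_nonneg hp (add_nonneg (add_nonneg n1 n2) n3)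
  refine le_mul_of_one_le_right hp ?_
  have hP := hgP (z₁ + fA a) (z₂ + (fA a + fB b)) (a, b) (by
    change JointlyTypical q δ _ _
    rw [e1, e2]; exact hT)
  generalize g (z₁ + fA a) (z₂ + (fA a + fB b)) = ab' at hg hP
  obtain ⟨a', b'⟩ := ab'
  have hc : confusion q δ z₁ z₂ (fA a - fA a') (fB b - fB b') = 1 := by
    refine if_pos ?_
    have hP' : JointlyTypical q δ (z₁ + fA a - fA a')
      (z₂ + (fA a + fB b) - fA a' - fB b') := hP
    convert hP' using 1 <;> abel
  by_cases ha : a' = a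
  · have hb : b' ≠ b := fun hb => hg (by rw [ha, hb])
    rw [ha, sub_self] at hc
    have := Finset.single_le_sum (f := fun b' => confusion q δ z₁ z₂ 0 (fB b - fB b'))
      (fun _ _ => confusion_nonneg ..) (Finset.mem_erase.2 ⟨hb, Finset.mem_univ b'⟩)
    linarith
  · by_cases hb : b' = b
    · rw [hb, sub_self] at hc
      have := Finset.single_le_sum (f := fun a' => confusion q δ z₁ z₂ (fA a - fA a') 0)
        (fun _ _ => confusion_nonneg ..) (Finset.mem_erase.2 ⟨ha, Finset.mem_univ a'⟩)
      linarith
    · have h1 := Finset.single_le_sum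
        (f := fun a' => ∑ b' ∈ Finset.univ.erase b, confusion q δ z₁ z₂ (fA a - fA a') (fB b - fB b'))
        (fun _ _ => Finset.sum_nonneg fun _ _ => confusion_nonneg ..)
        (Finset.mem_erase.2 ⟨ha, Finset.mem_univ a'⟩)
      have h2 := Finset.single_le_sum
        (f := fun b' => confusion q δ z₁ z₂ (fA a - fA a') (fB b - fB b'))
        (fun _ _ => confusion_nonneg ..) (Finset.mem_erase.2 ⟨hb, Finset.mem_univ b'⟩)
      linarith

lemma exists_injective_label (M : ℕ) : ∃ u : Fin M → Word (Nat.clog 2 M), Function.Injective u := by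
  have : Fintype.card (Fin M) ≤ Fintype.card (Word (Nat.clog 2 M)) := by
    simpa [Fintype.card_pi, ZMod.card] using Nat.le_pow_clog one_lt_two M
  obtain ⟨e⟩ := Function.Embedding.nonempty_of_card_le this
  exact ⟨e, e.injective⟩

/-- Random coding bound for linear encoders. -/
theorem exists_linear_code {q : Crossover} (hq : q.Valid) (δ : ℝ) {n MA MB : ℕ}
    (hA : 0 < MA) (hB : 0 < MB) :
    ∃ (fA : Fin MA → Word n) (fB : Fin MB → Word n) (g : Word n → Word n → Fin MA × Fin MB),
      IsLinearEncoder fA ∧ IsLinearEncoder fB ∧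
      errorProb q fA fB g ≤ jointAtypicalMass q δ n +
        (((MA : ℝ) - 1) * (2 : ℝ) ^
            (n * (3 * δ - (bscCapacity q.p14 + bscCapacity q.p' - bscCapacity q.p''))) +
          ((MB : ℝ) - 1) * (2 : ℝ) ^ (n * (δ - bscCapacity q.p')) +
          ((MA : ℝ) - 1) * ((MB : ℝ) - 1) *
            (2 : ℝ) ^ (n * (2 * δ - (bscCapacity q.p14 + bscCapacity q.p')))) := by
  classical
  obtain ⟨uA, huA⟩ := exists_injective_label MA
  obtain ⟨uB, huB⟩ := exists_injective_label MB
  let GA := Matrix (Fin (Nat.clog 2 MA)) (Fin n) (ZMod 2)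
  let GB := Matrix (Fin (Nat.clog 2 MB)) (Fin n) (ZMod 2)
  choose g hg using fun G : GA × GB => exists_decoder hq δ hA hB (fun a => uA a ᵥ* G.1)
    (fun b => uB b ᵥ* G.2)
  set KA : ℝ := (2 : ℝ) ^
    (n * (3 * δ - (bscCapacity q.p14 + bscCapacity q.p' - bscCapacity q.p''))) with hKA
  set KB : ℝ := (2 : ℝ) ^ (n * (δ - bscCapacity q.p')) with hKB
  set KC : ℝ := (2 : ℝ) ^ (n * (2 * δ - (bscCapacity q.p14 + bscCapacity q.p'))) with hKC
  set B : ℝ := ((MA : ℝ) - 1) * KA + ((MB : ℝ) - 1) * KB + ((MA : ℝ) - 1) * ((MB : ℝ) - 1) * KC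
    with hBdef
  set NA : ℝ := (Fintype.card GA : ℝ) with hNA
  set NB : ℝ := (Fintype.card GB : ℝ) with hNB
  have cA : ∀ (a : Fin MA), ((Finset.univ.erase a).card : ℝ) = (MA : ℝ) - 1 := fun a => by
    rw [Finset.card_erase_of_mem (Finset.mem_univ a), Finset.card_univ, Fintype.card_fin,
      Nat.cast_sub hA, Nat.cast_one]
  have cB : ∀ (b : Fin MB), ((Finset.univ.erase b).card : ℝ) = (MB : ℝ) - 1 := fun b => by
    rw [Finset.card_erase_of_mem (Finset.mem_univ b), Finset.card_univ, Fintype.card_fin,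
      Nat.cast_sub hB, Nat.cast_one]
  -- By linearity a codeword difference is the image of the label difference, which is nonzero; this
  -- is all that `sum_vecMul` needs.
  have dA : ∀ a a', a' ≠ a → uA a - uA a' ≠ 0 := fun a a' h h0 =>
    h (huA (sub_eq_zero.1 h0)).symm
  have dB : ∀ b b', b' ≠ b → uB b - uB b' ≠ 0 := fun b b' h h0 =>
    h (huB (sub_eq_zero.1 h0)).symm
  have bA : ∀ (z : Word n × Word n) a a', a' ≠ a →
      ∑ G : GA × GB, confusion q δ z.1 z.2 (uA a ᵥ* G.1 - uA a' ᵥ* G.1) 0 ≤ NA * NB * KA := by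
    intro z a a' h
    rw [Fintype.sum_prod_type]
    simp_rw [← Matrix.sub_vecMul]
    simp only [Finset.sum_const, Finset.card_univ, nsmul_eq_mul, ← Finset.mul_sum]
    rw [sum_vecMul (dA a a' h) fun w => confusion q δ z.1 z.2 w 0]
    have h1 := mul_le_mul_of_nonneg_left (sum_confusion_left hq δ z.1 z.2)
      (Real.rpow_pos_of_pos two_pos (-(n : ℝ))).le
    rw [← Real.rpow_add two_pos] at h1
    have h2 : -(n : ℝ) + n * (entropyBits q.p14 + entropyBits q.p' - entropyBits q.p'' + 3 * δ) =
        n * (3 * δ - (bscCapacity q.p14 + bscCapacity q.p' - bscCapacity q.p'')) := by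
      simp only [bscCapacity_eq]; ring
    rw [h2, ← hKA] at h1
    calc _ = NA * NB * ((2 : ℝ) ^ (-(n : ℝ)) * ∑ w, confusion q δ z.1 z.2 w 0) := by
          rw [hNA, hNB]; ring
      _ ≤ _ := mul_le_mul_of_nonneg_left h1 (by positivity)
  have bB : ∀ (z : Word n × Word n) b b', b' ≠ b →
      ∑ G : GA × GB, confusion q δ z.1 z.2 0 (uB b ᵥ* G.2 - uB b' ᵥ* G.2) ≤ NA * NB * KB := by
    intro z b b' h
    rw [Fintype.sum_prod_type]
    simp_rw [← Matrix.sub_vecMul]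
    simp only [Finset.sum_const, Finset.card_univ, nsmul_eq_mul]
    rw [sum_vecMul (dB b b' h) fun w => confusion q δ z.1 z.2 0 w]
    have h1 := mul_le_mul_of_nonneg_left (sum_confusion_right hq δ z.1 z.2 0)
      (Real.rpow_pos_of_pos two_pos (-(n : ℝ))).le
    rw [← Real.rpow_add two_pos] at h1
    have h2 : -(n : ℝ) + n * (entropyBits q.p' + δ) = n * (δ - bscCapacity q.p') := by
      simp only [bscCapacity_eq]; ring
    rw [h2, ← hKB] at h1
    calc _ = NA * NB * ((2 : ℝ) ^ (-(n : ℝ)) * ∑ w, confusion q δ z.1 z.2 0 w) := by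
          rw [hNA, hNB]; ring
      _ ≤ _ := mul_le_mul_of_nonneg_left h1 (by positivity)
  have bC : ∀ (z : Word n × Word n) a a' b b', a' ≠ a → b' ≠ b →
      ∑ G : GA × GB, confusion q δ z.1 z.2 (uA a ᵥ* G.1 - uA a' ᵥ* G.1)
        (uB b ᵥ* G.2 - uB b' ᵥ* G.2) ≤ NA * NB * KC := by
    intro z a a' b b' ha hb
    rw [Fintype.sum_prod_type]
    simp_rw [← Matrix.sub_vecMul]
    have : ∀ x : GA, ∑ y : GB, confusion q δ z.1 z.2 ((uA a - uA a') ᵥ* x)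
        ((uB b - uB b') ᵥ* y) = NB * ((2 : ℝ) ^ (-(n : ℝ)) *
          ∑ w₂, confusion q δ z.1 z.2 ((uA a - uA a') ᵥ* x) w₂) := fun x =>
      sum_vecMul (dB b b' hb) fun w => confusion q δ z.1 z.2 _ w
    simp_rw [this]
    -- The two matrices are chosen independently, so the pair of differences is uniform on pairs of
    -- words.
    rw [sum_vecMul (dA a a' ha) fun w => NB * ((2 : ℝ) ^ (-(n : ℝ)) *
      ∑ w₂, confusion q δ z.1 z.2 w w₂), ← Finset.mul_sum, ← Finset.mul_sum]
    have h1 := mul_le_mul_of_nonneg_left (sum_confusion_both hq δ z.1 z.2)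
      (Real.rpow_pos_of_pos two_pos (-(n : ℝ) + -(n : ℝ))).le
    rw [← Real.rpow_add two_pos] at h1
    have h2 : -(n : ℝ) + -(n : ℝ) + n * (entropyBits q.p14 + entropyBits q.p' + 2 * δ) =
        n * (2 * δ - (bscCapacity q.p14 + bscCapacity q.p')) := by
      simp only [bscCapacity_eq]; ring
    rw [h2, ← hKC, Real.rpow_add two_pos] at h1
    calc _ = NA * NB * ((2 : ℝ) ^ (-(n : ℝ)) * (2 : ℝ) ^ (-(n : ℝ)) *
            ∑ w₁, ∑ w₂, confusion q δ z.1 z.2 w₁ w₂) := by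
          rw [hNA, hNB]; ring
      _ ≤ _ := mul_le_mul_of_nonneg_left h1 (by positivity)
  have hone : ∑ z : Word n × Word n, noise q.p14 z.1 * noise q.p' z.2 = 1 := by
    rw [Fintype.sum_prod_type]
    simp_rw [← Finset.mul_sum, sum_noise, mul_one, sum_noise]
  have hM : (0 : ℝ) < MA * MB := by positivity
  have havg : ∑ G : GA × GB,
      errorProb q (fun a => uA a ᵥ* G.1) (fun b => uB b ᵥ* G.2) (g G) * (MA * MB) ≤
      ∑ _G : GA × GB, (jointAtypicalMass q δ n + B) * (MA * MB) := by
    refine (Finset.sum_le_sum fun G _ => hg G).trans ?_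
    rw [Finset.sum_add_distrib]
    simp only [Finset.sum_const, Finset.card_univ, nsmul_eq_mul]
    rw [Fintype.card_prod, Nat.cast_mul, ← hNA, ← hNB, add_mul, mul_add,
      mul_comm (MA * MB : ℝ) (jointAtypicalMass q δ n)]
    refine add_le_add le_rfl ?_
    rw [Finset.sum_comm]
    have : ∀ ab : Fin MA × Fin MB, ∑ G : GA × GB, ∑ z : Word n × Word n,
        noise q.p14 z.1 * noise q.p' z.2 *
          (∑ a ∈ Finset.univ.erase ab.1,
              confusion q δ z.1 z.2 (uA ab.1 ᵥ* G.1 - uA a ᵥ* G.1) 0 +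
           ∑ b ∈ Finset.univ.erase ab.2,
              confusion q δ z.1 z.2 0 (uB ab.2 ᵥ* G.2 - uB b ᵥ* G.2) +
           ∑ a ∈ Finset.univ.erase ab.1, ∑ b ∈ Finset.univ.erase ab.2,
             confusion q δ z.1 z.2 (uA ab.1 ᵥ* G.1 - uA a ᵥ* G.1)
              (uB ab.2 ᵥ* G.2 - uB b ᵥ* G.2)) ≤ NA * NB * B := by
      intro ab
      rw [Finset.sum_comm]
      calc _ ≤ ∑ z : Word n × Word n, noise q.p14 z.1 * noise q.p' z.2 * (NA * NB * B) := by
            refine Finset.sum_le_sum fun z _ => ?_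
            rw [← Finset.mul_sum]
            refine mul_le_mul_of_nonneg_left ?_
              (mul_nonneg (noise_nonneg hq.2.2.2 _) (noise_nonneg hq.p'_mem _))
            rw [Finset.sum_add_distrib, Finset.sum_add_distrib]
            have s1 : ∑ G : GA × GB, ∑ a ∈ Finset.univ.erase ab.1,
                confusion q δ z.1 z.2 (uA ab.1 ᵥ* G.1 - uA a ᵥ* G.1) 0 ≤
                (MA - 1) * (NA * NB * KA) := by
              rw [Finset.sum_comm, ← cA ab.1, ← nsmul_eq_mul]
              exact Finset.sum_le_card_nsmul _ _ _ fun a ha => bA z _ _ (Finset.ne_of_mem_erase ha)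
            have s2 : ∑ G : GA × GB, ∑ b ∈ Finset.univ.erase ab.2,
                confusion q δ z.1 z.2 0 (uB ab.2 ᵥ* G.2 - uB b ᵥ* G.2) ≤
                (MB - 1) * (NA * NB * KB) := by
              rw [Finset.sum_comm, ← cB ab.2, ← nsmul_eq_mul]
              exact Finset.sum_le_card_nsmul _ _ _ fun a ha => bB z _ _ (Finset.ne_of_mem_erase ha)
            have s3 : ∑ G : GA × GB, ∑ a ∈ Finset.univ.erase ab.1, ∑ b ∈ Finset.univ.erase ab.2,
                confusion q δ z.1 z.2 (uA ab.1 ᵥ* G.1 - uA a ᵥ* G.1)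
                  (uB ab.2 ᵥ* G.2 - uB b ᵥ* G.2) ≤
                (MA - 1) * ((MB - 1) * (NA * NB * KC)) := by
              rw [Finset.sum_comm, ← cA ab.1, ← nsmul_eq_mul]
              refine Finset.sum_le_card_nsmul _ _ _ fun a ha => ?_
              rw [Finset.sum_comm, ← cB ab.2, ← nsmul_eq_mul]
              exact Finset.sum_le_card_nsmul _ _ _ fun b hb =>
                bC z _ _ _ _ (Finset.ne_of_mem_erase ha) (Finset.ne_of_mem_erase hb)
            refine (add_le_add (add_le_add s1 s2) s3).trans_eq ?_
            rw [hBdef]; ring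
        _ = _ := by rw [← Finset.sum_mul, hone, one_mul]
    refine (Finset.sum_le_card_nsmul _ _ _ fun ab _ => this ab).trans_eq ?_
    rw [Finset.card_univ, Fintype.card_prod, Fintype.card_fin, Fintype.card_fin, nsmul_eq_mul,
      Nat.cast_mul]
    ring
  -- Some pair of generator matrices does no worse than the average.
  obtain ⟨G, -, hG⟩ := Finset.exists_le_of_sum_le (s := (Finset.univ : Finset (GA × GB)))
    Finset.univ_nonempty havg
  exact ⟨_, _, g G, ⟨uA, G.1, huA, fun _ => rfl⟩, ⟨uB, G.2, huB, fun _ => rfl⟩,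
    le_of_mul_le_mul_right hG hM⟩

/-! ### From the error bound to rates -/

lemma numMessages_zero (n : ℕ) : numMessages n 0 = 1 := by simp [numMessages]

lemma numMessages_le (n : ℕ) (R : ℝ) : (numMessages n R : ℝ) ≤ (2 : ℝ) ^ (n * R) :=
  Nat.floor_le (by positivity)

lemma one_le_numMessages (n : ℕ) {R : ℝ} (hR : 0 ≤ R) : (1 : ℝ) ≤ numMessages n R := by
  exact_mod_cast numMessages_pos n hR

lemma tendsto_two_rpow_mul {x : ℝ} (hx : x < 0) :
    Tendsto (fun n : ℕ => (2 : ℝ) ^ (n * x)) atTop (𝓝 0) := by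
  have h : (2 : ℝ) ^ x < 1 := Real.rpow_lt_one_of_one_lt_of_neg one_lt_two hx
  refine (tendsto_pow_atTop_nhds_zero_of_lt_one (by positivity) h).congr fun n => ?_
  rw [← Real.rpow_natCast, ← Real.rpow_mul two_pos.le, mul_comm]

/-- At rate 0 there is a single message, so the factor `M - 1` vanishes whatever the exponent. This
covers degenerate regions, where a zero bound cannot be met strictly. -/
lemma tendsto_numMessages_mul {R e : ℝ} (hR : 0 ≤ R) (h : R = 0 ∨ R + e < 0) :
    Tendsto (fun n : ℕ => ((numMessages n R : ℝ) - 1) * (2 : ℝ) ^ (n * e)) atTop (𝓝 0) := by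
  rcases h with rfl | h
  · simp [numMessages_zero]
  · refine squeeze_zero (fun n => ?_) (fun n => ?_) (tendsto_two_rpow_mul h)
    · exact mul_nonneg (sub_nonneg.2 (one_le_numMessages n hR)) (by positivity)
    · rw [mul_add, Real.rpow_add two_pos]
      gcongr
      linarith [numMessages_le n R]

lemma tendsto_numMessages_mul_mul {RA RB e : ℝ} (hA : 0 ≤ RA) (hB : 0 ≤ RB)
    (h : RA = 0 ∨ RB = 0 ∨ RA + RB + e < 0) :
    Tendsto (fun n : ℕ => ((numMessages n RA : ℝ) - 1) * ((numMessages n RB : ℝ) - 1) *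
      (2 : ℝ) ^ (n * e)) atTop (𝓝 0) := by
  rcases h with rfl | rfl | h
  · simp [numMessages_zero]
  · simp [numMessages_zero]
  · refine squeeze_zero (fun n => ?_) (fun n => ?_) (tendsto_two_rpow_mul h)
    · exact mul_nonneg (mul_nonneg (sub_nonneg.2 (one_le_numMessages n hA))
        (sub_nonneg.2 (one_le_numMessages n hB))) (by positivity)
    · rw [mul_add, mul_add, Real.rpow_add two_pos, Real.rpow_add two_pos]
      have := sub_nonneg.2 (one_le_numMessages n hB)
      gcongr
      · linarith [numMessages_le n RA]
      · linarith [numMessages_le n RB]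

lemma mem_achievableLinear {q : Crossover} (hq : q.Valid) {RA RB : ℝ} (hA : 0 ≤ RA) (hB : 0 ≤ RB)
    (h1 : RA = 0 ∨ RA < bscCapacity q.p14 + bscCapacity q.p' - bscCapacity q.p'')
    (h2 : RB = 0 ∨ RB < bscCapacity q.p')
    (h3 : RA = 0 ∨ RB = 0 ∨ RA + RB < bscCapacity q.p14 + bscCapacity q.p') :
    (RA, RB) ∈ achievableLinear q := by
  refine ⟨hA, hB, ?_⟩
  dsimp only
  intro ε hε
  -- The slacks in the three exponents are `3 δ`, `δ` and `2 δ`; the largest serves for all.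
  have small : ∀ {x y : ℝ}, x < y → ∀ᶠ δ : ℝ in 𝓝[>] 0, x + 3 * δ < y := fun {x y} hxy => by
    have : Tendsto (fun δ : ℝ => x + 3 * δ) (𝓝[>] 0) (𝓝 x) :=
      (Continuous.tendsto' (by fun_prop) 0 x (by simp)).mono_left nhdsWithin_le_nhds
    exact this.eventually (gt_mem_nhds hxy)
  have e1 : ∀ᶠ δ : ℝ in 𝓝[>] 0, RA = 0 ∨
      RA + 3 * δ < bscCapacity q.p14 + bscCapacity q.p' - bscCapacity q.p'' := by
    rcases h1 with h | h
    · exact Eventually.of_forall fun _ => Or.inl h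
    · exact (small h).mono fun _ => Or.inr
  have e2 : ∀ᶠ δ : ℝ in 𝓝[>] 0, RB = 0 ∨ RB + 3 * δ < bscCapacity q.p' := by
    rcases h2 with h | h
    · exact Eventually.of_forall fun _ => Or.inl h
    · exact (small h).mono fun _ => Or.inr
  have e3 : ∀ᶠ δ : ℝ in 𝓝[>] 0, RA = 0 ∨ RB = 0 ∨
      RA + RB + 3 * δ < bscCapacity q.p14 + bscCapacity q.p' := by
    rcases h3 with h | h | h
    · exact Eventually.of_forall fun _ => Or.inl h
    · exact Eventually.of_forall fun _ => Or.inr (Or.inl h)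
    · exact (small h).mono fun _ h => Or.inr (Or.inr h)
  obtain ⟨δ, ⟨⟨k1, k2⟩, k3⟩, hδ'⟩ := (((e1.and e2).and e3).and self_mem_nhdsWithin).exists
  have hδ : 0 < δ := hδ'
  have ht := (tendsto_jointAtypicalMass hq hδ).add (((tendsto_numMessages_mul hA
    (e := 3 * δ - (bscCapacity q.p14 + bscCapacity q.p' - bscCapacity q.p''))
    (k1.imp_right fun h => by linarith)).add (tendsto_numMessages_mul hB
    (e := δ - bscCapacity q.p') (k2.imp_right fun h => by linarith))).add
    (tendsto_numMessages_mul_mul hA hB (e := 2 * δ - (bscCapacity q.p14 + bscCapacity q.p'))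
    (k3.imp_right fun h => h.imp_right fun h => by linarith)))
  simp only [add_zero] at ht
  obtain ⟨N, hN⟩ := eventually_atTop.1 (ht.eventually (gt_mem_nhds hε))
  refine ⟨N, fun n hn => ?_⟩
  obtain ⟨fA, fB, g, lA, lB, hg⟩ := exists_linear_code hq δ (n := n) (numMessages_pos n hA)
    (numMessages_pos n hB)
  exact ⟨fA, fB, g, lA, lB, hg.trans_lt (hN n hn)⟩

/-- Scaling towards the origin by `t < 1` makes the constraints on positive rates strict and keeps
zero rates zero; then `t` tends to 1. -/
theorem ratePairs_subset_closure {q : Crossover} (hq : q.Valid) :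
    ratePairs q ⊆ closure (achievableLinear q) := by
  rintro ⟨RA, RB⟩ ⟨hA, hB, h1, h2, h3⟩
  dsimp only at hA hB h1 h2 h3
  have ht : Tendsto (fun t : ℝ => (t * RA, t * RB)) (𝓝[<] 1) (𝓝 (RA, RB)) :=
    (Continuous.tendsto' (by fun_prop) 1 (RA, RB) (by simp)).mono_left nhdsWithin_le_nhds
  have hlt : ∀ {t x y : ℝ}, t < 1 → 0 ≤ x → x ≤ y → x = 0 ∨ t * x < y := fun {t x y} ht hx hxy => by
    rcases hx.eq_or_lt with h | h
    · exact Or.inl h.symm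
    · exact Or.inr (by nlinarith)
  refine mem_closure_of_tendsto ht ?_
  filter_upwards [self_mem_nhdsWithin,
    mem_nhdsWithin_of_mem_nhds (lt_mem_nhds (zero_lt_one (α := ℝ)))] with t ht1 ht0
  have ht1' : t < 1 := ht1
  have ht0' : 0 < t := ht0
  refine mem_achievableLinear hq (by positivity) (by positivity)
    ((hlt ht1' hA h1).imp_left fun h => by simp [h])
    ((hlt ht1' hB h2).imp_left fun h => by simp [h]) ?_
  rcases hlt ht1' (add_nonneg hA hB) h3 with h | h
  · left
    have : RA = 0 := by linarith
    simp [this]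
  · right; right
    linarith

/-! ### Closedness and convexity of the region, and the theorem -/

lemma isClosed_ratePairs (q : Crossover) : IsClosed (ratePairs q) := by
  unfold ratePairs
  simp only [Set.ofPred_and]
  refine IsClosed.inter ?_ (IsClosed.inter ?_ (IsClosed.inter ?_ (IsClosed.inter ?_ ?_))) <;>
    exact isClosed_le (by fun_prop) (by fun_prop)

lemma convex_ratePairs (q : Crossover) : Convex ℝ (ratePairs q) := by
  rintro ⟨x1, x2⟩ ⟨a1, a2, a3, a4, a5⟩ ⟨y1, y2⟩ ⟨b1, b2, b3, b4, b5⟩ s t hs ht hst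
  dsimp only at *
  obtain rfl : t = 1 - s := by linarith
  refine ⟨?_, ?_, ?_, ?_, ?_⟩ <;>
    simp only [Prod.fst_add, Prod.snd_add, Prod.smul_mk, smul_eq_mul]
  · positivity
  · positivity
  · nlinarith
  · nlinarith
  · nlinarith

lemma achievableLinear_subset (q : Crossover) : achievableLinear q ⊆ achievable q := by
  rintro R ⟨hA, hB, h⟩
  refine ⟨hA, hB, fun ε hε => ?_⟩
  obtain ⟨N, hN⟩ := h ε hε
  refine ⟨N, fun n hn => ?_⟩
  obtain ⟨fA, fB, g, -, -, hg⟩ := hN n hn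
  exact ⟨fA, fB, g, hg⟩

end RelayNet

theorem theorem3 (q : RelayNet.Crossover) (hq : q.Valid) :
    closure (RelayNet.achievableLinear q) = convexHull ℝ (RelayNet.ratePairs q) ∧
      closure (RelayNet.achievable q) = convexHull ℝ (RelayNet.ratePairs q) := by
  have hsub : closure (RelayNet.achievable q) ⊆ RelayNet.ratePairs q :=
    closure_minimal (RelayNet.achievable_subset_ratePairs hq) (RelayNet.isClosed_ratePairs q)
  have hlin : closure (RelayNet.achievableLinear q) ⊆ closure (RelayNet.achievable q) :=
    closure_mono (RelayNet.achievableLinear_subset q)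
  have hsup := RelayNet.ratePairs_subset_closure hq
  rw [(RelayNet.convex_ratePairs q).convexHull_eq]
  exact ⟨(hlin.trans hsub).antisymm hsup, hsub.antisymm (hsup.trans hlin)⟩
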